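/- Let $X$ be a (real or complex) Hilbert space, $U$ a Banach space over the same field, and let $A=A^*:D(A)\subset X\to X$ be a self-adjoint operator generating an exponentially stable $C_0$-semigroup $T=(T(t))_{t\ge 0}$ on $X$, i.e. $\|T(t)\|\le Me^{-\omega t}$ for all $t\ge 0$ with some $M\ge 1$, $\omega>0$. Fix $a\in\rho(A)$, let $X_{-1}$ be the completion of $X$ with respect to $x\mapsto\|(aI-A)^{-1}x\|$, and let $T_{-1}(t)$ be the continuous extension of $T(t)$ to $X_{-1}$. Let $X_{-1/2}$ be the completion of $X$ with respect to $x\mapsto\|(-A)^{-1/2}x\|$, where $(-A)^{-1/2}x=\Gamma(\tfrac12)^{-1}\int_0^\infty t^{-1/2}T(t)x\,dt$, canonically embedded in $X_{-1}$. Let $B\in L(U,X_{-1/2})$, regarded as an element of $L(U,X_{-1})$. Then $V:X\to[0,\infty)$, $V(x)=\frac12\|x\|^2$, is a coercive quadratic $L^2$-ISS Lyapunov function for the system $\Sigma(A,B)$: $\dot x(t)=Ax(t)+Bu(t)$, that is: 1. $B$ is $C$-admissible: for all $t\ge0$ and $u\in C([0,t],U)$ the integral $\int_0^tT_{-1}(t-s)Bu(s)\,ds$,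 which exists in $X_{-1}$, belongs to $X$. In particular, for every $x_0\in X$ and $u\in C([0,\infty),U)$ the mild solution $x(t)=T(t)x_0+\int_0^tT_{-1}(t-s)Bu(s)\,ds$, $t\ge 0$, takes values in $X$. 2. $V$ is continuous and nonnegative, and there is a continuous strictly increasing unbounded function $\alpha_2:[0,\infty)\to[0,\infty)$ with $\alpha_2(0)=0$ such that $0<V(x)\le\alpha_2(\|x\|)$ for all $x\ne0$. 3. There are constants $a_3,a_4>0$ such that for all $x_0\in X$ and all $u\in C([0,\infty),U)$ the mild solution $x(\cdot)$ with $x(0)=x_0$ and input $u$ satisfies $$\dot V_u(x_0):=\limsup_{h\to0^+}\frac1h\bigl(V(x(h))-V(x_0)\bigr)\le -a_3\|x_0\|^2+a_4\|u(0)\|_U^2,$$ where the limsup is taken in $[-\infty,\infty]$. 4. $V$ is quadratic: there is an injective bounded linear operator $F\in L(X)$ with $V(x)=\|Fx\|^2$ for all $x\in X$. 5. $V$ is coercive: there are constants $a_1,a_2>0$ with $a_1\|x\|^2\le V(x)\le a_2\|x\|^2$ for all $x\in X$. -/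

import Mathlib

open Set Filter Topology MeasureTheory

noncomputable section

namespace LinSys

section Semigroups

variable {𝕜 X : Type*} [RCLike 𝕜] [NormedAddCommGroup X] [NormedSpace 𝕜 X] [NormedSpace ℝ X]

/-- `T` (restricted to times `t ≥ 0`) is a strongly continuous semigroup of bounded operators;
the values at negative times are irrelevant. -/
structure IsC0Semigroup (T : ℝ → X →L[𝕜] X) : Prop where
  map_zero : T 0 = ContinuousLinearMap.id 𝕜 X
  map_add : ∀ s t : ℝ, 0 ≤ s → 0 ≤ t → T (s + t) = (T s).comp (T t)
  tendsto_zero : ∀ x : X, Tendsto (fun t => T t x) (𝓝[>] (0 : ℝ)) (𝓝 x)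

/-- The partially defined operator `A` is the infinitesimal generator of `T`: `x` lies in `D(A)`
with `A x = y` if and only if the difference quotients `(T h x - x) / h` converge to `y`
as `h → 0+`. -/
def IsGenerator (T : ℝ → X →L[𝕜] X) (A : X →ₗ.[𝕜] X) : Prop :=
  ∀ x y : X, (x, y) ∈ A.graph ↔
    Tendsto (fun h : ℝ => h⁻¹ • (T h x - x)) (𝓝[>] (0 : ℝ)) (𝓝 y)

/-- Exponential stability of a semigroup. -/
def IsExpStable (T : ℝ → X →L[𝕜] X) : Prop :=
  ∃ M ω : ℝ, 0 < ω ∧ ∀ t : ℝ, 0 ≤ t → ‖T t‖ ≤ M * Real.exp (-ω * t)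

open Classical in
/-- The negative fractional power `(-A)^{-α}`, `α > 0`, of the generator `A` of an exponentially
stable semigroup `T`: the bounded operator
`x ↦ Γ(α)⁻¹ ∫_0^∞ t^{α-1} T(t) x dt`. -/
def negFracPow (T : ℝ → X →L[𝕜] X) (α : ℝ) : X →L[𝕜] X :=
  if h : ∃ R : X →L[𝕜] X, ∀ x : X,
      R x = (Real.Gamma α)⁻¹ • ∫ t in Ioi (0 : ℝ), t ^ (α - 1) • T t x
  then h.choose else 0

end Semigroups

section Resolvent

variable {𝕜 X : Type*} [RCLike 𝕜] [NormedAddCommGroup X] [NormedSpace 𝕜 X]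

/-- `R` is a bounded two-sided inverse of `a I - A : D(A) → X`. -/
def IsResolventAt (A : X →ₗ.[𝕜] X) (a : 𝕜) (R : X →L[𝕜] X) : Prop :=
  (∀ x : X, ∃ h : R x ∈ A.domain, a • R x - A ⟨R x, h⟩ = x) ∧
    ∀ x : A.domain, R (a • (x : X) - A x) = x

/-- The resolvent set `ρ(A)`. -/
def resolventSet (A : X →ₗ.[𝕜] X) : Set 𝕜 :=
  {a | ∃ R : X →L[𝕜] X, IsResolventAt A a R}

open Classical in
/-- The resolvent operator `(a I - A)⁻¹` for `a ∈ ρ(A)` (and `0` otherwise). -/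
def resolventOp (A : X →ₗ.[𝕜] X) (a : 𝕜) : X →L[𝕜] X :=
  if h : ∃ R : X →L[𝕜] X, IsResolventAt A a R then h.choose else 0

theorem resolventOp_spec (A : X →ₗ.[𝕜] X) {a : 𝕜} (ha : a ∈ resolventSet A) :
    IsResolventAt A a (resolventOp A a) := by
  have h : ∃ R : X →L[𝕜] X, IsResolventAt A a R := ha
  rw [resolventOp, dif_pos h]
  exact h.choose_spec

end Resolvent

section Extrapolation

variable {𝕜 X : Type*} [RCLike 𝕜] [NormedAddCommGroup X] [NormedSpace 𝕜 X]

/-- The vector space `X`, to be equipped with the (semi)norm `x ↦ ‖R x‖`. -/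
def NormVia (_R : X →L[𝕜] X) : Type _ := X

instance (R : X →L[𝕜] X) : AddCommGroup (NormVia R) := inferInstanceAs (AddCommGroup X)

instance (R : X →L[𝕜] X) : Module 𝕜 (NormVia R) := inferInstanceAs (Module 𝕜 X)

instance [NormedSpace ℝ X] (R : X →L[𝕜] X) : Module ℝ (NormVia R) := inferInstanceAs (Module ℝ X)

/-- `R`, viewed as a linear map from `NormVia R` to `X`. -/
def NormVia.toX (R : X →L[𝕜] X) : NormVia R →ₗ[𝕜] X := R.toLinearMap

/-- The norm of `x` in `NormVia R` is `‖R x‖`. -/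
instance (R : X →L[𝕜] X) : SeminormedAddCommGroup (NormVia R) :=
  SeminormedAddCommGroup.induced (NormVia R) X (NormVia.toX R)

theorem NormVia.norm_def (R : X →L[𝕜] X) (x : X) : ‖(show NormVia R from x)‖ = ‖R x‖ := rfl

instance (R : X →L[𝕜] X) : NormedSpace 𝕜 (NormVia R) :=
  NormedSpace.induced 𝕜 (NormVia R) X (NormVia.toX R)

instance [NormedSpace ℝ X] (R : X →L[𝕜] X) : NormedSpace ℝ (NormVia R) where
  norm_smul_le c x := by
    have h : R (c • (show X from x)) = c • R (show X from x) :=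
      map_real_smul R R.continuous c _
    exact (congrArg norm h).trans_le (norm_smul_le c (R (show X from x)))

/-- The completion of `X` with respect to the norm `x ↦ ‖R x‖`. -/
abbrev Extrap (R : X →L[𝕜] X) : Type _ := UniformSpace.Completion (NormVia R)

/-- The canonical map of `X` into its completion with respect to `x ↦ ‖R x‖`. -/
def toExtrap (R : X →L[𝕜] X) (x : X) : Extrap R :=
  ((show NormVia R from x : NormVia R) : UniformSpace.Completion (NormVia R))

/-- The continuous extension of `S : X → X` to a map between two completions of `X`
(for `S` uniformly continuous with respect to the two norms). -/
def extendMap (R R' : X →L[𝕜] X) (S : X →L[𝕜] X) : Extrap R → Extrap R' :=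
  UniformSpace.Completion.map (fun x : NormVia R => (show NormVia R' from S (show X from x)))

end Extrapolation

section Systems

variable {𝕜 X U : Type*} [RCLike 𝕜] [NormedAddCommGroup X] [NormedSpace 𝕜 X] [NormedSpace ℝ X]
  [NormedAddCommGroup U] [NormedSpace 𝕜 U]

/-- The extrapolation space `X_{-1}`: the completion of `X` with respect to
`x ↦ ‖(a I - A)⁻¹ x‖`, where `a ∈ ρ(A)`. -/
abbrev XMinusOne (A : X →ₗ.[𝕜] X) (a : 𝕜) : Type _ := Extrap (resolventOp A a)

/-- The space `X_{-α}`, `α > 0`: the completion of `X` with respect to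
`x ↦ ‖(-A)^{-α} x‖`. -/
abbrev XMinus (T : ℝ → X →L[𝕜] X) (α : ℝ) : Type _ := Extrap (negFracPow T α)

/-- The canonical map `X → X_{-1}`. -/
def incl (A : X →ₗ.[𝕜] X) (a : 𝕜) : X → XMinusOne A a := toExtrap (resolventOp A a)

/-- The extended semigroup operators `T_{-1}(t)` on `X_{-1}`. -/
def extSemigroup (A : X →ₗ.[𝕜] X) (a : 𝕜) (T : ℝ → X →L[𝕜] X) (t : ℝ) :
    XMinusOne A a → XMinusOne A a :=
  extendMap (resolventOp A a) (resolventOp A a) (T t)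

/-- The canonical embedding `X_{-α} → X_{-1}`, i.e. the continuous extension of the identity
of `X`. -/
def inclMinus (A : X →ₗ.[𝕜] X) (a : 𝕜) (T : ℝ → X →L[𝕜] X) (α : ℝ) :
    XMinus T α → XMinusOne A a :=
  extendMap (negFracPow T α) (resolventOp A a) (ContinuousLinearMap.id 𝕜 X)

/-- `B ∈ L(U, X_{-1})` belongs to `L(U, X_{-α})`: it factors as a bounded operator
`U → X_{-α}` followed by the embedding `X_{-α} → X_{-1}`. -/
def MemLXMinus (A : X →ₗ.[𝕜] X) (a : 𝕜) (T : ℝ → X →L[𝕜] X) (α : ℝ)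
    (B : U →L[𝕜] XMinusOne A a) : Prop :=
  ∃ B' : U →L[𝕜] XMinus T α, ∀ v : U, inclMinus A a T α (B' v) = B v

/-- The integrand `s ↦ T_{-1}(t - s) B u(s)`, with values in `X_{-1}`. -/
def inputIntegrand (A : X →ₗ.[𝕜] X) (a : 𝕜) (T : ℝ → X →L[𝕜] X) (B : U →L[𝕜] XMinusOne A a)
    (u : ℝ → U) (t : ℝ) (s : ℝ) : XMinusOne A a :=
  extSemigroup A a T (t - s) (B (u s))

/-- `B` is `C`-admissible: for every `t ≥ 0` and every `u ∈ C([0,t], U)`, the integral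
`∫_0^t T_{-1}(t-s) B u(s) ds` (which exists in `X_{-1}`) lies in `X`. -/
def IsCAdmissible (A : X →ₗ.[𝕜] X) (a : 𝕜) (T : ℝ → X →L[𝕜] X)
    (B : U →L[𝕜] XMinusOne A a) : Prop :=
  ∀ t : ℝ, 0 ≤ t → ∀ u : ℝ → U, ContinuousOn u (Icc 0 t) →
    IntervalIntegrable (inputIntegrand A a T B u t) volume 0 t ∧
      ∃ z : X, incl A a z = ∫ s in (0 : ℝ)..t, inputIntegrand A a T B u t s

/-- `x : [0,∞) → X` is the mild solution of `x' = A x + B u`, `x(0) = x₀`: the identity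
`x(t) = T(t) x₀ + ∫_0^t T_{-1}(t-s) B u(s) ds` holds in `X_{-1}` for all `t ≥ 0`. -/
def IsMildSolution (A : X →ₗ.[𝕜] X) (a : 𝕜) (T : ℝ → X →L[𝕜] X)
    (B : U →L[𝕜] XMinusOne A a) (x₀ : X) (u : ℝ → U) (x : ℝ → X) : Prop :=
  ∀ t : ℝ, 0 ≤ t →
    incl A a (x t) = incl A a (T t x₀) + ∫ s in (0 : ℝ)..t, inputIntegrand A a T B u t s

/-- The upper right-hand Dini derivative at `0` of `f`, as an extended real number
(it may be `-∞`, e.g. along trajectories that start outside `D(A)`). -/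
def diniAtZero (f : ℝ → ℝ) : EReal :=
  limsup (fun h : ℝ => (((f h - f 0) / h : ℝ) : EReal)) (𝓝[>] (0 : ℝ))

/-- Comparison functions of class `K_∞` (as functions on `[0,∞)`). -/
structure IsClassKInfty (α : ℝ → ℝ) : Prop where
  continuousOn : ContinuousOn α (Ici 0)
  strictMonoOn : StrictMonoOn α (Ici 0)
  map_zero : α 0 = 0
  tendsto_atTop : Tendsto α atTop atTop

/-- `V : X → [0,∞)` is a (non-coercive) `L^p`-ISS Lyapunov function for the system `Σ(A,B)`
with `C`-admissible `B`. -/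
structure IsLpISSLyapunov (A : X →ₗ.[𝕜] X) (a : 𝕜) (T : ℝ → X →L[𝕜] X)
    (B : U →L[𝕜] XMinusOne A a) (p : ℝ) (V : X → ℝ) : Prop where
  admissible : IsCAdmissible A a T B
  continuous : Continuous V
  nonneg : ∀ x : X, 0 ≤ V x
  sandwich : ∃ α₂ : ℝ → ℝ, IsClassKInfty α₂ ∧ ∀ x : X, x ≠ 0 → 0 < V x ∧ V x ≤ α₂ ‖x‖
  decay : ∃ a₃ a₄ : ℝ, 0 < a₃ ∧ 0 < a₄ ∧
    ∀ (x₀ : X) (u : ℝ → U), ContinuousOn u (Ici 0) →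
      ∀ x : ℝ → X, IsMildSolution A a T B x₀ u x →
        diniAtZero (fun t => V (x t)) ≤ ((-a₃ * ‖x₀‖ ^ 2 + a₄ * ‖u 0‖ ^ p : ℝ) : EReal)

/-- `V` is a coercive quadratic `L^p`-ISS Lyapunov function for `Σ(A,B)`. -/
structure IsCoerciveQuadraticLpISSLyapunov (A : X →ₗ.[𝕜] X) (a : 𝕜) (T : ℝ → X →L[𝕜] X)
    (B : U →L[𝕜] XMinusOne A a) (p : ℝ) (V : X → ℝ) : Prop
    extends IsLpISSLyapunov A a T B p V where
  quadratic : ∃ F : X →L[𝕜] X, Function.Injective F ∧ ∀ x : X, V x = ‖F x‖ ^ 2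
  coercive : ∃ a₁ a₂ : ℝ, 0 < a₁ ∧ 0 < a₂ ∧
    ∀ x : X, a₁ * ‖x‖ ^ 2 ≤ V x ∧ V x ≤ a₂ * ‖x‖ ^ 2

end Systems

end LinSys

end

/-! Write R = (-A)^{-1/2}, Q = (aI - A)^{-1} and P = I - aQ. Polar coordinates in the Gaussian form
of R give R² = ∫_0^∞ T(t) dt, so AR² = -I, R is injective and Q = PR². Extending R isometrically to
X_{-1/2} turns B into a bounded G : U → X. Extending Q to X_{-1} and cancelling the injective PR,
the mild solution identity becomes Rx(t) = RT(t)x₀ + ∫_0^t T(t-s)Gu(s) ds in X (`incl_eq_iff`).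

Self-adjointness of A passes to T(t) and R. It yields ‖T(t)‖ ≤ e^{-ωt} without the constant M, and
the energy identity ∫_0^h ‖T(s)w‖² ds = (‖Rw‖² - ‖T(h)Rw‖²)/2. Pairing the convolution with w and
using Young's inequality bounds the pairing by the input energy and ‖Rw‖²
(`norm_inner_convolution_le`). By Hahn-Banach and Riesz the convolution then lies in the range of R,
which is admissibility. Testing x(h) against the dense vectors Rw gives ‖x(h)‖² ≤ e^{-ωh}‖x₀‖² +
∫_0^h ‖Gu‖² (`norm_sq_le`); differentiating this majorant at h = 0 is the decay estimate. -/

namespace LinSys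

/-! ### Orbits, resolvents and two changes of variables. -/

section Orbits

variable {𝕜 X : Type*} [RCLike 𝕜] [NormedAddCommGroup X] [NormedSpace 𝕜 X]
  {T : ℝ → X →L[𝕜] X} {M ω : ℝ}

theorem norm_orbit_le (hb : ∀ t : ℝ, 0 ≤ t → ‖T t‖ ≤ M * Real.exp (-ω * t)) {t : ℝ} (ht : 0 ≤ t)
    (x : X) : ‖T t x‖ ≤ M * ‖x‖ * Real.exp (-ω * t) :=
  ((T t).le_of_opNorm_le (hb t ht) x).trans_eq (by ring)

/-- Orbits of an exponentially bounded `C₀`-semigroup are continuous on `[0,∞)`. -/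
theorem IsC0Semigroup.continuousOn_orbit (hT : IsC0Semigroup T) (hω : 0 ≤ ω)
    (hb : ∀ t : ℝ, 0 ≤ t → ‖T t‖ ≤ M * Real.exp (-ω * t)) (x : X) :
    ContinuousOn (fun t => T t x) (Ici 0) := by
  have h0 : Tendsto (fun r : ℝ => T r x) (𝓝[≥] 0) (𝓝 x) := by
    have h : ContinuousWithinAt (fun r : ℝ => T r x) (Ici 0) 0 := by
      rw [← continuousWithinAt_Ioi_iff_Ici]
      have h := hT.tendsto_zero x
      simpa [ContinuousWithinAt, hT.map_zero] using h
    simpa [ContinuousWithinAt, hT.map_zero] using h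
  have hM : ∀ t : ℝ, 0 ≤ t → ‖T t‖ ≤ M := fun t ht => by
    refine (hb t ht).trans ?_
    have hM0 : 0 ≤ M := by simpa using (norm_nonneg _).trans (hb 0 le_rfl)
    exact mul_le_of_le_one_right hM0 (Real.exp_le_one_iff.2 (by nlinarith))
  have key : ∀ t s : ℝ, 0 ≤ s → s ≤ t → ‖T t x - T s x‖ ≤ M * ‖T |t - s| x - x‖ := by
    intro t s hs hst
    have h : T t x = T s (T |t - s| x) := by
      rw [← ContinuousLinearMap.comp_apply, ← hT.map_add s _ hs (abs_nonneg _),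
        abs_of_nonneg (sub_nonneg.2 hst)]
      congr 2; ring
    rw [h, ← map_sub]
    exact (T s).le_of_opNorm_le (hM s hs) _
  intro s hs
  rw [ContinuousWithinAt, tendsto_iff_norm_sub_tendsto_zero]
  have habs : Tendsto (fun t : ℝ => |t - s|) (𝓝[Ici 0] s) (𝓝[≥] 0) := by
    refine tendsto_nhdsWithin_iff.2 ⟨?_, Eventually.of_forall fun t => mem_Ici.2 (abs_nonneg _)⟩
    have h : Continuous fun t : ℝ => |t - s| := by fun_prop
    simpa using (h.tendsto s).mono_left nhdsWithin_le_nhds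
  have hlim : Tendsto (fun t : ℝ => M * ‖T |t - s| x - x‖) (𝓝[Ici 0] s) (𝓝 0) := by
    have h := ((tendsto_iff_norm_sub_tendsto_zero.1 (h0.comp habs)).const_mul M)
    simpa using h
  refine squeeze_zero' (Eventually.of_forall fun _ => norm_nonneg _) ?_ hlim
  filter_upwards [self_mem_nhdsWithin] with t ht
  rcases le_total s t with h | h
  · exact key t s hs h
  · rw [norm_sub_rev, abs_sub_comm]
    exact key s t ht h

theorem IsC0Semigroup.continuous_orbit_comp (hT : IsC0Semigroup T) (hω : 0 ≤ ω)
    (hb : ∀ t : ℝ, 0 ≤ t → ‖T t‖ ≤ M * Real.exp (-ω * t)) (x : X)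
    {Y : Type*} [TopologicalSpace Y] {f : Y → ℝ} (hf : Continuous f) (h0 : ∀ y, 0 ≤ f y) :
    Continuous fun y => T (f y) x := by
  rw [← continuousOn_univ]
  exact (hT.continuousOn_orbit hω hb x).comp hf.continuousOn fun y _ => h0 y

theorem IsC0Semigroup.integrableOn_orbit (hT : IsC0Semigroup T) (hω : 0 < ω)
    (hb : ∀ t : ℝ, 0 ≤ t → ‖T t‖ ≤ M * Real.exp (-ω * t)) (x : X) :
    IntegrableOn (fun t => T t x) (Ioi 0) := by
  refine Integrable.mono' (g := fun t => M * ‖x‖ * Real.exp (-ω * t))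
    ((integrableOn_exp_mul_Ioi (neg_lt_zero.2 hω) 0).const_mul _)
    (((hT.continuousOn_orbit hω.le hb x).mono Ioi_subset_Ici_self).aestronglyMeasurable
      measurableSet_Ioi) ?_
  filter_upwards [ae_restrict_mem measurableSet_Ioi] with t ht
  exact norm_orbit_le hb (le_of_lt ht) x

theorem IsC0Semigroup.integrable_orbit_sq (hT : IsC0Semigroup T) (hω : 0 < ω)
    (hb : ∀ t : ℝ, 0 ≤ t → ‖T t‖ ≤ M * Real.exp (-ω * t)) (x : X) :
    Integrable fun p : ℝ => T (p ^ 2) x := by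
  refine Integrable.mono' (g := fun p => M * ‖x‖ * Real.exp (-ω * p ^ 2))
    ((integrable_exp_neg_mul_sq hω).const_mul _)
    (hT.continuous_orbit_comp hω.le hb x (by fun_prop) fun p => sq_nonneg p).aestronglyMeasurable ?_
  exact Eventually.of_forall fun p => norm_orbit_le hb (sq_nonneg p) x

theorem IsC0Semigroup.integrable_orbit_sq_add_sq (hT : IsC0Semigroup T) (hω : 0 < ω)
    (hb : ∀ t : ℝ, 0 ≤ t → ‖T t‖ ≤ M * Real.exp (-ω * t)) (x : X) :
    Integrable fun p : ℝ × ℝ => T (p.1 ^ 2 + p.2 ^ 2) x := by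
  have hint : Integrable fun p : ℝ × ℝ =>
      (M * ‖x‖) * (Real.exp (-ω * p.1 ^ 2) * Real.exp (-ω * p.2 ^ 2)) := by
    have h := (integrable_exp_neg_mul_sq hω).mul_prod (integrable_exp_neg_mul_sq hω)
    exact h.const_mul _
  have hcont : Continuous fun p : ℝ × ℝ => T (p.1 ^ 2 + p.2 ^ 2) x :=
    hT.continuous_orbit_comp (f := fun p : ℝ × ℝ => p.1 ^ 2 + p.2 ^ 2) hω.le hb x (by fun_prop)
      fun p => add_nonneg (sq_nonneg p.1) (sq_nonneg p.2)
  refine hint.mono' hcont.aestronglyMeasurable (Eventually.of_forall fun p => ?_)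
  rw [← Real.exp_add, ← mul_add]
  exact norm_orbit_le hb (add_nonneg (sq_nonneg p.1) (sq_nonneg p.2)) x

theorem IsC0Semigroup.map_comm (hT : IsC0Semigroup T) {s t : ℝ} (hs : 0 ≤ s) (ht : 0 ≤ t) (x : X) :
    T s (T t x) = T t (T s x) := by
  rw [← ContinuousLinearMap.comp_apply, ← hT.map_add s t hs ht, add_comm, hT.map_add t s ht hs]
  rfl

theorem IsC0Semigroup.intervalIntegrable_orbit (hT : IsC0Semigroup T) (hω : 0 ≤ ω)
    (hb : ∀ t : ℝ, 0 ≤ t → ‖T t‖ ≤ M * Real.exp (-ω * t)) {h : ℝ} (hh : 0 ≤ h) (x : X) :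
    IntervalIntegrable (fun t => T t x) volume 0 h :=
  ContinuousOn.intervalIntegrable ((hT.continuousOn_orbit hω hb x).mono (by
    rw [uIcc_of_le hh]; exact Icc_subset_Ici_self))

variable {A : X →ₗ.[𝕜] X} {a : 𝕜} {Q : X →L[𝕜] X}

theorem IsResolventAt.mem_graph (hQ : IsResolventAt A a Q) (x : X) :
    (Q x, a • Q x - x) ∈ A.graph := by
  obtain ⟨h, hx⟩ := hQ.1 x
  rw [LinearPMap.mem_graph_iff]
  exact ⟨⟨Q x, h⟩, rfl, by rw [← sub_eq_iff_eq_add'.2 (sub_eq_iff_eq_add.1 hx)]⟩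

theorem IsResolventAt.apply_of_mem_graph (hQ : IsResolventAt A a Q) {x y : X}
    (h : (x, y) ∈ A.graph) : Q (a • x - y) = x := by
  obtain ⟨z, rfl, rfl⟩ := (LinearPMap.mem_graph_iff _).1 h
  exact hQ.2 z

theorem IsResolventAt.injective (hQ : IsResolventAt A a Q) : Function.Injective Q := by
  rw [injective_iff_map_eq_zero]
  intro x hx
  have h := hQ.mem_graph x
  rw [hx] at h
  simpa using A.mem_graph_snd_inj h A.graph.zero_mem rfl

theorem IsGenerator.orbit_mem_graph [NormedSpace ℝ X] (hA : IsGenerator T A)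
    (hT : IsC0Semigroup T) {t : ℝ} (ht : 0 ≤ t) {x y : X} (hxy : (x, y) ∈ A.graph) : (T t x, T t y) ∈ A.graph := by
  rw [hA] at hxy ⊢
  refine (((T t).continuous.tendsto y).comp hxy).congr' ?_
  filter_upwards [self_mem_nhdsWithin] with h (hh : 0 < h)
  rw [Function.comp_apply, map_real_smul _ (T t).continuous, map_sub, hT.map_comm ht hh.le]

/-- The substitution t = p² absorbs the singular weight t^{-1/2}, and evenness in p replaces twice
the half-line by the whole line. -/
theorem integral_rpow_neg_half_smul {E : Type*} [NormedAddCommGroup E] [NormedSpace ℝ E]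
    (f : ℝ → E) (hf : Integrable fun p : ℝ => f (p ^ 2)) :
    ∫ t in Ioi (0 : ℝ), t ^ ((1 / 2 : ℝ) - 1) • f t = ∫ p : ℝ, f (p ^ 2) := by
  rw [← integral_comp_rpow_Ioi_of_pos (g := fun t => t ^ ((1 / 2 : ℝ) - 1) • f t) two_pos]
  have h1 : ∫ x in Ioi (0 : ℝ), ((2 : ℝ) * x ^ ((2 : ℝ) - 1)) •
      ((x ^ (2 : ℝ)) ^ ((1 / 2 : ℝ) - 1) • f (x ^ (2 : ℝ))) =
      ∫ x in Ioi (0 : ℝ), (2 : ℝ) • f (x ^ 2) := by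
    refine setIntegral_congr_fun measurableSet_Ioi fun x (hx : 0 < x) => ?_
    simp only [smul_smul]
    rw [← Real.rpow_mul hx.le, mul_assoc, ← Real.rpow_add hx]
    norm_num
  rw [h1, integral_smul, two_smul]
  have h2 : ∫ x in Iic (0 : ℝ), f (x ^ 2) = ∫ x in Ioi (0 : ℝ), f (x ^ 2) := by
    have h := integral_comp_neg_Iic (0 : ℝ) fun x => f (x ^ 2)
    simpa using h
  nth_rewrite 1 [← h2]
  have := integral_add_compl (measurableSet_Iic (a := (0 : ℝ))) hf
  rwa [compl_Iic] at this

/-- In polar coordinates the angle contributes 2π, and t = r² makes r dr equal to dt/2. -/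
theorem integral_comp_sq_add_sq {E : Type*} [NormedAddCommGroup E] [NormedSpace ℝ E]
    (f : ℝ → E) :
    ∫ p : ℝ × ℝ, f (p.1 ^ 2 + p.2 ^ 2) = Real.pi • ∫ t in Ioi (0 : ℝ), f t := by
  rw [← integral_comp_polarCoord_symm]
  have h1 : ∀ p : ℝ × ℝ, p.1 • f ((polarCoord.symm p).1 ^ 2 + (polarCoord.symm p).2 ^ 2) =
      p.1 • f (p.1 ^ 2) := by
    intro p
    rw [polarCoord_symm_apply]
    congr 2
    have := Real.sin_sq_add_cos_sq p.2
    simp only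
    linear_combination p.1 ^ 2 * this
  simp_rw [h1]
  have h2 : ∫ t in Ioi (0 : ℝ), f t = (2 : ℝ) • ∫ r in Ioi (0 : ℝ), r • f (r ^ 2) := by
    rw [← integral_comp_rpow_Ioi_of_pos (g := f) two_pos, ← integral_smul]
    refine setIntegral_congr_fun measurableSet_Ioi fun x (hx : 0 < x) => ?_
    simp only [smul_smul]
    norm_num
  have h3 : polarCoord.target = Ioi (0 : ℝ) ×ˢ Ioo (-Real.pi) Real.pi := rfl
  rw [h3, h2, smul_smul, Measure.volume_eq_prod, ← Measure.prod_restrict,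
    integral_fun_fst (fun r : ℝ => r • f (r ^ 2))]
  congr 1
  simp [Measure.real, Real.pi_pos.le]
  ring

end Orbits

/-! ### The operator (-A)^{-1/2} and its relation to the resolvent. -/

section NegHalfPower

variable {𝕜 X : Type*} [RCLike 𝕜] [NormedAddCommGroup X] [NormedSpace 𝕜 X] [NormedSpace ℝ X]
  [CompleteSpace X] {T : ℝ → X →L[𝕜] X} {M ω : ℝ}

/-- The definition chooses an operator only if a bounded one exists; the Gaussian bound M e^{-ωp²}
provides it. The factor is Γ(1/2) = √π. -/
theorem IsC0Semigroup.negFracPow_half_apply (hT : IsC0Semigroup T) (hω : 0 < ω)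
    (hb : ∀ t : ℝ, 0 ≤ t → ‖T t‖ ≤ M * Real.exp (-ω * t)) (x : X) :
    negFracPow T (1 / 2) x = (√Real.pi)⁻¹ • ∫ p : ℝ, T (p ^ 2) x := by
  have hex : ∃ R : X →L[𝕜] X, ∀ x : X,
      R x = (Real.Gamma (1 / 2))⁻¹ • ∫ t in Ioi (0 : ℝ), t ^ ((1 / 2 : ℝ) - 1) • T t x := by
    have hI := hT.integrable_orbit_sq hω hb
    let L : X →ₗ[𝕜] X :=
      { toFun := fun x => (√Real.pi)⁻¹ • ∫ p : ℝ, T (p ^ 2) x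
        map_add' := fun x y => by
          rw [← smul_add, ← integral_add (hI x) (hI y)]
          simp_rw [fun p : ℝ => (T (p ^ 2)).map_add x y]
        map_smul' := fun c x => by
          -- Multiplication by c, seen as a bounded operator, passes through the integral; being
          -- additive and continuous, it also commutes with real scalars.
          have h1 : ∫ p : ℝ, T (p ^ 2) (c • x) = c • ∫ p : ℝ, T (p ^ 2) x := by
            simp_rw [fun p : ℝ => (T (p ^ 2)).map_smul c x]
            exact (c • ContinuousLinearMap.id 𝕜 X).integral_comp_comm (hI x)
          rw [h1, RingHom.id_apply]
          exact (map_real_smul (c • ContinuousLinearMap.id 𝕜 X)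
            (ContinuousLinearMap.continuous _) _ _).symm }
    refine ⟨L.mkContinuous ((√Real.pi)⁻¹ * (M * ∫ p : ℝ, Real.exp (-ω * p ^ 2))) fun x => ?_,
      fun x => ?_⟩
    · change ‖(√Real.pi)⁻¹ • ∫ p : ℝ, T (p ^ 2) x‖ ≤ _
      rw [norm_smul, Real.norm_of_nonneg (by positivity), mul_assoc]
      refine mul_le_mul_of_nonneg_left ?_ (by positivity)
      calc ‖∫ p : ℝ, T (p ^ 2) x‖ ≤ ∫ p : ℝ, M * ‖x‖ * Real.exp (-ω * p ^ 2) :=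
            norm_integral_le_of_norm_le ((integrable_exp_neg_mul_sq hω).const_mul _)
              (Eventually.of_forall fun p => norm_orbit_le hb (sq_nonneg p) x)
        _ = _ := by rw [integral_const_mul]; ring
    · rw [integral_rpow_neg_half_smul _ (hI x), Real.Gamma_one_half_eq]
      rfl
  rw [negFracPow, dif_pos hex, hex.choose_spec x,
    integral_rpow_neg_half_smul _ (hT.integrable_orbit_sq hω hb x), Real.Gamma_one_half_eq]

theorem IsC0Semigroup.negFracPow_half_comm (hT : IsC0Semigroup T) (hω : 0 < ω)
    (hb : ∀ t : ℝ, 0 ≤ t → ‖T t‖ ≤ M * Real.exp (-ω * t)) {S : X →L[𝕜] X}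
    (hS : ∀ t : ℝ, 0 ≤ t → ∀ x, S (T t x) = T t (S x)) (x : X) :
    S (negFracPow T (1 / 2) x) = negFracPow T (1 / 2) (S x) := by
  rw [hT.negFracPow_half_apply hω hb, hT.negFracPow_half_apply hω hb,
    map_real_smul S S.continuous, ← S.integral_comp_comm (hT.integrable_orbit_sq hω hb x)]
  simp only [hS _ (sq_nonneg _)]

/-- The square of `(-A)^{-1/2}` is the integral of the semigroup. -/
theorem IsC0Semigroup.negFracPow_half_sq (hT : IsC0Semigroup T) (hω : 0 < ω)
    (hb : ∀ t : ℝ, 0 ≤ t → ‖T t‖ ≤ M * Real.exp (-ω * t)) (x : X) :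
    negFracPow T (1 / 2) (negFracPow T (1 / 2) x) = ∫ t in Ioi (0 : ℝ), T t x := by
  have h1 : ∀ p : ℝ, T (p ^ 2) (negFracPow T (1 / 2) x) =
      (√Real.pi)⁻¹ • ∫ q : ℝ, T (p ^ 2 + q ^ 2) x := by
    intro p
    rw [hT.negFracPow_half_apply hω hb, map_real_smul (T (p ^ 2)) (T (p ^ 2)).continuous,
      ← (T (p ^ 2)).integral_comp_comm (hT.integrable_orbit_sq hω hb x)]
    simp only [hT.map_add _ _ (sq_nonneg _) (sq_nonneg _), ContinuousLinearMap.comp_apply]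
  rw [hT.negFracPow_half_apply hω hb (negFracPow T (1 / 2) x)]
  simp_rw [h1]
  rw [integral_smul, smul_smul,
    ← integral_prod (fun p : ℝ × ℝ => T (p.1 ^ 2 + p.2 ^ 2) x)
      (hT.integrable_orbit_sq_add_sq hω hb x),
    ← Measure.volume_eq_prod, integral_comp_sq_add_sq (fun t => T t x), smul_smul,
    ← mul_inv, Real.mul_self_sqrt Real.pi_pos.le, inv_mul_cancel₀ Real.pi_pos.ne', one_smul]

theorem IsC0Semigroup.orbit_negFracPow_half_comm (hT : IsC0Semigroup T) (hω : 0 < ω)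
    (hb : ∀ t : ℝ, 0 ≤ t → ‖T t‖ ≤ M * Real.exp (-ω * t)) {t : ℝ} (ht : 0 ≤ t) (x : X) :
    T t (negFracPow T (1 / 2) x) = negFracPow T (1 / 2) (T t x) :=
  hT.negFracPow_half_comm hω hb (fun _ hs x => hT.map_comm ht hs x) x

/-- Applying T(h) to ∫_0^∞ T(t)x dt shifts it to ∫_h^∞. -/
theorem IsC0Semigroup.negFracPow_half_sq_sub (hT : IsC0Semigroup T) (hω : 0 < ω)
    (hb : ∀ t : ℝ, 0 ≤ t → ‖T t‖ ≤ M * Real.exp (-ω * t)) {h : ℝ} (hh : 0 ≤ h) (x : X) :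
    negFracPow T (1 / 2) (negFracPow T (1 / 2) x) -
      T h (negFracPow T (1 / 2) (negFracPow T (1 / 2) x)) = ∫ t in (0 : ℝ)..h, T t x := by
  have hI := hT.integrableOn_orbit hω hb x
  rw [hT.negFracPow_half_sq hω hb, ← (T h).integral_comp_comm hI,
    ← intervalIntegral.integral_interval_add_Ioi hI (hI.mono_set (Ioi_subset_Ioi hh)),
    add_sub_assoc, add_eq_left, sub_eq_zero]
  have h1 : ∫ t in Ioi (0 : ℝ), T h (T t x) = ∫ t in Ioi (0 : ℝ), T (t + h) x := by
    refine setIntegral_congr_fun measurableSet_Ioi fun t (ht : 0 < t) => ?_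
    simp only [add_comm t h, hT.map_add h t hh ht.le, ContinuousLinearMap.comp_apply]
  rw [h1]
  have h2 := (measurePreserving_add_right volume h).setIntegral_preimage_emb
    (measurableEmbedding_addRight h) (fun t => T t x) (Ioi h)
  rw [← h2]
  simp

variable {A : X →ₗ.[𝕜] X}

/-- The difference quotient of the orbit of R²x is minus the mean of T(t)x over [0,h], which tends
to -x. -/
theorem IsGenerator.negFracPow_half_sq_mem_graph (hA : IsGenerator T A) (hT : IsC0Semigroup T)
    (hω : 0 < ω) (hb : ∀ t : ℝ, 0 ≤ t → ‖T t‖ ≤ M * Real.exp (-ω * t)) (x : X) :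
    (negFracPow T (1 / 2) (negFracPow T (1 / 2) x), -x) ∈ A.graph := by
  rw [hA]
  have hc := hT.continuousOn_orbit hω.le hb x
  have hd : HasDerivWithinAt (fun h => ∫ t in (0 : ℝ)..h, T t x) (T 0 x) (Ici 0) 0 :=
    intervalIntegral.integral_hasDerivWithinAt_right (s := Ici 0) (t := Ioi 0) (by simp)
      ((hc.mono Ioi_subset_Ici_self).stronglyMeasurableAtFilter_nhdsWithin measurableSet_Ioi 0)
      ((hc 0 self_mem_Ici).mono Ioi_subset_Ici_self)
  rw [hasDerivWithinAt_iff_tendsto_slope, Ici_sdiff_left, hT.map_zero] at hd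
  refine hd.neg.congr' ?_
  filter_upwards [self_mem_nhdsWithin] with h (hh : 0 < h)
  rw [slope_def_module, ← hT.negFracPow_half_sq_sub hω hb hh.le x]
  simp [← smul_neg]

theorem IsGenerator.negFracPow_half_sq_eq (hA : IsGenerator T A) (hT : IsC0Semigroup T)
    (hω : 0 < ω) (hb : ∀ t : ℝ, 0 ≤ t → ‖T t‖ ≤ M * Real.exp (-ω * t)) {x y : X}
    (hxy : (x, y) ∈ A.graph) : negFracPow T (1 / 2) (negFracPow T (1 / 2) y) = -x := by
  have hR := hA.negFracPow_half_sq_mem_graph hT hω hb x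
  rw [hA] at hxy hR
  set R := negFracPow T (1 / 2)
  have h1 := ((R.comp R).continuous.tendsto y).comp hxy
  refine tendsto_nhds_unique (h1.congr' ?_) hR
  filter_upwards [self_mem_nhdsWithin] with h (hh : 0 < h)
  rw [Function.comp_apply, map_real_smul _ (R.comp R).continuous, map_sub]
  simp only [ContinuousLinearMap.comp_apply, R, hT.orbit_negFracPow_half_comm hω hb hh.le]

theorem IsGenerator.negFracPow_half_injective (hA : IsGenerator T A) (hT : IsC0Semigroup T)
    (hω : 0 < ω) (hb : ∀ t : ℝ, 0 ≤ t → ‖T t‖ ≤ M * Real.exp (-ω * t)) :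
    Function.Injective (negFracPow T (1 / 2)) := by
  rw [injective_iff_map_eq_zero]
  intro x hx
  have h := hA.negFracPow_half_sq_mem_graph hT hω hb x
  rw [hx, map_zero] at h
  simpa using A.mem_graph_snd_inj h A.graph.zero_mem rfl

variable {a : 𝕜} {Q : X →L[𝕜] X}

omit [CompleteSpace X] in
theorem IsResolventAt.orbit_comm (hQ : IsResolventAt A a Q) (hA : IsGenerator T A)
    (hT : IsC0Semigroup T) {t : ℝ} (ht : 0 ≤ t) (x : X) : Q (T t x) = T t (Q x) := by
  have h := hQ.apply_of_mem_graph (hA.orbit_mem_graph hT ht (hQ.mem_graph x))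
  simpa using h

/-- Apply Q to (aI - A)R²x = aR²x + x. This factorisation is what compares the norms defining X_{-1}
and X_{-1/2}. -/
theorem IsResolventAt.eq_negFracPow (hQ : IsResolventAt A a Q) (hA : IsGenerator T A)
    (hT : IsC0Semigroup T) (hω : 0 < ω)
    (hb : ∀ t : ℝ, 0 ≤ t → ‖T t‖ ≤ M * Real.exp (-ω * t)) (x : X) :
    Q x = (ContinuousLinearMap.id 𝕜 X - a • Q)
      (negFracPow T (1 / 2) (negFracPow T (1 / 2) x)) := by
  have h := hQ.apply_of_mem_graph (hA.negFracPow_half_sq_mem_graph hT hω hb x)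
  simp only [sub_neg_eq_add, map_add, map_smul] at h
  simpa using eq_sub_iff_add_eq'.2 h

/-- `(-A)(aI - A)⁻¹` is injective. -/
theorem IsResolventAt.id_sub_smul_injective (hQ : IsResolventAt A a Q) (hA : IsGenerator T A)
    (hT : IsC0Semigroup T) (hω : 0 < ω)
    (hb : ∀ t : ℝ, 0 ≤ t → ‖T t‖ ≤ M * Real.exp (-ω * t)) :
    Function.Injective (ContinuousLinearMap.id 𝕜 X - a • Q) := by
  rw [injective_iff_map_eq_zero]
  intro x hx
  have h := hA.negFracPow_half_sq_eq hT hω hb (hQ.mem_graph x)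
  have hx' : a • Q x - x = 0 := by
    rw [← neg_eq_zero, neg_sub]; simpa using hx
  rw [hx', map_zero, map_zero, eq_comm, neg_eq_zero] at h
  exact hQ.injective (by rw [h, map_zero])

end NegHalfPower

/-! ### Consequences of self-adjointness and the energy identity. -/

section SelfAdjoint

variable {𝕜 X : Type*} [RCLike 𝕜] [NormedAddCommGroup X] [InnerProductSpace 𝕜 X] [NormedSpace ℝ X]
  [CompleteSpace X] {T : ℝ → X →L[𝕜] X} {M ω : ℝ} {A : X →ₗ.[𝕜] X}

local notation "⟪" x ", " y "⟫" => inner 𝕜 x y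

theorem IsGenerator.inner_negFracPow_half_sq (hA : IsGenerator T A) (hT : IsC0Semigroup T)
    (hω : 0 < ω) (hb : ∀ t : ℝ, 0 ≤ t → ‖T t‖ ≤ M * Real.exp (-ω * t)) (hself : IsSelfAdjoint A)
    (x y : X) : ⟪negFracPow T (1 / 2) (negFracPow T (1 / 2) x), y⟫ =
      ⟪x, negFracPow T (1 / 2) (negFracPow T (1 / 2) y)⟫ := by
  have hsymm : A.IsFormalAdjoint A := by
    have h := A.adjoint_isFormalAdjoint hself.dense_domain
    rwa [LinearPMap.isSelfAdjoint_def.1 hself] at h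
  obtain ⟨x', hx, hx'⟩ := (LinearPMap.mem_graph_iff _).1
    (hA.negFracPow_half_sq_mem_graph hT hω hb x)
  obtain ⟨y', hy, hy'⟩ := (LinearPMap.mem_graph_iff _).1
    (hA.negFracPow_half_sq_mem_graph hT hω hb y)
  have h := hsymm x' y'
  rw [hx, hx', hy, hy', inner_neg_left, inner_neg_right, neg_inj] at h
  exact h.symm

-- Injectivity of the symmetric C lets vectors be compared by pairing with its range alone: first S
-- and its adjoint agree on that range, then everywhere.
omit [NormedSpace ℝ X] in
theorem inner_eq_of_inner_range_eq {C S : X →L[𝕜] X} (hC : ∀ x y, ⟪C x, y⟫ = ⟪x, C y⟫)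
    (hinj : Function.Injective C) (hS : ∀ x y, ⟪S (C x), C y⟫ = ⟪C x, S (C y)⟫) (x y : X) :
    ⟪S x, y⟫ = ⟪x, S y⟫ := by
  have h1 : ∀ z, S (C z) = ContinuousLinearMap.adjoint S (C z) := fun z => by
    refine hinj (ext_inner_right 𝕜 fun w => ?_)
    rw [hC, hC, hS, ContinuousLinearMap.adjoint_inner_left]
  have h2 : ContinuousLinearMap.adjoint S y = S y := by
    refine hinj (ext_inner_left 𝕜 fun w => ?_)
    rw [← hC, ← hC, ContinuousLinearMap.adjoint_inner_right, h1,
      ContinuousLinearMap.adjoint_inner_left]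
  rw [← h2, ContinuousLinearMap.adjoint_inner_right]

/-- A `C₀`-semigroup with self-adjoint generator consists of self-adjoint operators. -/
theorem IsGenerator.inner_orbit (hA : IsGenerator T A) (hT : IsC0Semigroup T)
    (hω : 0 < ω) (hb : ∀ t : ℝ, 0 ≤ t → ‖T t‖ ≤ M * Real.exp (-ω * t)) (hself : IsSelfAdjoint A)
    {t : ℝ} (ht : 0 ≤ t) (x y : X) : ⟪T t x, y⟫ = ⟪x, T t y⟫ := by
  set R := negFracPow T (1 / 2) with hR
  have hC := hA.inner_negFracPow_half_sq hT hω hb hself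
  have hcomm : ∀ {s : ℝ}, 0 ≤ s → ∀ z, T s (R (R z)) = R (R (T s z)) := fun hs z => by
    rw [hT.orbit_negFracPow_half_comm hω hb hs, hT.orbit_negFracPow_half_comm hω hb hs]
  have hinj := hA.negFracPow_half_injective hT hω hb
  refine inner_eq_of_inner_range_eq (C := R.comp R) hC (hinj.comp hinj) (fun x y => ?_) x y
  -- This agrees with T(h)R²z for h ≥ 0 but is differentiable on all of ℝ, so the endpoints need no
  -- separate treatment.
  let S : X → ℝ → X := fun z h => R (R z) - ∫ r in (0 : ℝ)..h, T (max r 0) z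
  have hS : ∀ z h, 0 ≤ h → S z h = T h (R (R z)) := fun z h hh => by
    have h1 : ∫ r in (0 : ℝ)..h, T (max r 0) z = ∫ r in (0 : ℝ)..h, T r z := by
      refine intervalIntegral.integral_congr fun r hr => ?_
      rw [uIcc_of_le hh] at hr
      simp only [max_eq_left hr.1]
    simp only [S]
    rw [h1, ← hT.negFracPow_half_sq_sub hω hb hh, sub_sub_cancel]
  have hS' : ∀ z h, HasDerivAt (S z) (-T (max h 0) z) h := fun z h => by
    have hc : Continuous fun r => T (max r 0) z :=
      hT.continuous_orbit_comp hω.le hb z (by fun_prop) fun r => le_max_right r 0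
    exact (hc.integral_hasStrictDerivAt 0 h).hasDerivAt.const_sub _
  have hφ : ∀ s, HasDerivAt (fun s => ⟪S x s, S y (t - s)⟫)
      (⟪S x s, T (max (t - s) 0) y⟫ + ⟪-T (max s 0) x, S y (t - s)⟫) s := fun s => by
    have h2 : HasDerivAt (fun s => S y (t - s)) (T (max (t - s) 0) y) s := by
      have h := (hS' y (t - s)).scomp s ((hasDerivAt_id s).const_sub t)
      simpa [Function.comp_def] using h
    exact (hS' x s).inner 𝕜 h2
  have h0 : ∀ s ∈ Ico 0 t, ⟪S x s, T (max (t - s) 0) y⟫ + ⟪-T (max s 0) x, S y (t - s)⟫ = 0 := by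
    intro s hs
    have hts : 0 ≤ t - s := sub_nonneg.2 hs.2.le
    rw [max_eq_left hs.1, max_eq_left hts, hS x s hs.1, hS y _ hts, inner_neg_left, hcomm hs.1,
      hcomm hts, ← sub_eq_add_neg, sub_eq_zero]
    exact hC _ _
  -- Thus s ↦ ⟪T(s)R²x, T(t-s)R²y⟫ is constant on [0,t]; its values at 0 and t give the symmetry of
  -- T(t) on the range of R².
  have hconst := constant_of_has_deriv_right_zero
    (fun s _ => (hφ s).continuousAt.continuousWithinAt)
    (fun s hs => by rw [← h0 s hs]; exact (hφ s).hasDerivWithinAt) t (right_mem_Icc.2 ht)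
  simp only [sub_self, sub_zero] at hconst
  rw [hS x t ht, hS y 0 le_rfl, hS x 0 le_rfl, hS y t ht, hT.map_zero] at hconst
  exact hconst

theorem IsGenerator.inner_negFracPow_half (hA : IsGenerator T A) (hT : IsC0Semigroup T)
    (hω : 0 < ω) (hb : ∀ t : ℝ, 0 ≤ t → ‖T t‖ ≤ M * Real.exp (-ω * t)) (hself : IsSelfAdjoint A)
    (x y : X) : ⟪negFracPow T (1 / 2) x, y⟫ = ⟪x, negFracPow T (1 / 2) y⟫ := by
  have key : ∀ x y : X, ⟪x, negFracPow T (1 / 2) y⟫ =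
      (√Real.pi)⁻¹ • ∫ p : ℝ, ⟪x, T (p ^ 2) y⟫ := fun x y => by
    rw [hT.negFracPow_half_apply hω hb, integral_inner (hT.integrable_orbit_sq hω hb y)]
    exact map_real_smul (innerSL 𝕜 x) (innerSL 𝕜 x).continuous _ _
  rw [← inner_conj_symm, key, key, RCLike.real_smul_eq_coe_mul, map_mul, RCLike.conj_ofReal,
    ← integral_conj, RCLike.real_smul_eq_coe_mul]
  simp only [inner_conj_symm, hA.inner_orbit hT hω hb hself (sq_nonneg _)]

/-- Self-adjointness gives ‖T(t)‖^{2^n} = ‖T(2^n t)‖ ≤ M e^{-ω 2^n t}; if the ratio ‖T(t)‖/e^{-ωt}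
exceeded 1, its powers would outgrow M. -/
theorem IsGenerator.norm_orbit_le_exp (hA : IsGenerator T A) (hT : IsC0Semigroup T)
    (hω : 0 < ω) (hb : ∀ t : ℝ, 0 ≤ t → ‖T t‖ ≤ M * Real.exp (-ω * t)) (hself : IsSelfAdjoint A)
    {t : ℝ} (ht : 0 ≤ t) : ‖T t‖ ≤ Real.exp (-ω * t) := by
  have hsa := (ContinuousLinearMap.isSelfAdjoint_iff_isSymmetric (A := T t)).2
    (hA.inner_orbit hT hω hb hself ht)
  have hpow : ∀ n : ℕ, T t ^ n = T (n * t) := fun n => by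
    induction n with
    | zero => simp [hT.map_zero]; rfl
    | succ n ih =>
      rw [pow_succ, ih, Nat.cast_succ, add_mul, one_mul, hT.map_add _ _ (by positivity) ht]
      rfl
  have hle : ∀ n : ℕ, ‖T t‖ ^ 2 ^ n ≤ M * Real.exp (-ω * t) ^ 2 ^ n := fun n => by
    have h := congrArg NNReal.toReal (IsSelfAdjoint.nnnorm_pow_two_pow (E := X →L[𝕜] X) hsa n)
    simp only [coe_nnnorm, NNReal.coe_pow] at h
    rw [← h, hpow, ← Real.exp_nat_mul]
    refine (hb _ (by positivity)).trans_eq ?_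
    congr 2; ring
  by_contra! hlt
  have hr : 1 < ‖T t‖ / Real.exp (-ω * t) := (one_lt_div (Real.exp_pos _)).2 hlt
  have htop : Tendsto (fun n : ℕ => (‖T t‖ / Real.exp (-ω * t)) ^ 2 ^ n) atTop atTop :=
    (tendsto_pow_atTop_atTop_of_one_lt hr).comp (tendsto_pow_atTop_atTop_of_one_lt one_lt_two)
  obtain ⟨n, hn⟩ := (htop.eventually_gt_atTop M).exists
  refine hn.not_ge ?_
  rw [div_pow, div_le_iff₀ (pow_pos (Real.exp_pos _) _)]
  exact hle n

/-- The energy identity `∫_0^h ‖T(s)w‖² ds = (‖y‖² - ‖T(h)y‖²)/2` for `y = (-A)^{-1/2}w`. -/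
theorem IsGenerator.integral_norm_orbit_sq (hA : IsGenerator T A) (hT : IsC0Semigroup T)
    (hω : 0 < ω) (hb : ∀ t : ℝ, 0 ≤ t → ‖T t‖ ≤ M * Real.exp (-ω * t)) (hself : IsSelfAdjoint A)
    {h : ℝ} (hh : 0 ≤ h) (w : X) :
    ∫ s in (0 : ℝ)..h, ‖T s w‖ ^ 2 =
      (‖negFracPow T (1 / 2) w‖ ^ 2 - ‖T h (negFracPow T (1 / 2) w)‖ ^ 2) / 2 := by
  set R := negFracPow T (1 / 2) with hR
  have hsymm := fun {t : ℝ} => hA.inner_orbit hT hω hb hself (t := t)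
  have hRs := hA.inner_negFracPow_half hT hω hb hself
  have h2 : 0 ≤ 2 * h := by positivity
  -- The endpoint 2h comes from ‖T(s)w‖² = ⟪w, T(2s)w⟫; both sides equal Re⟪w, (I - T(2h))R²w⟫.
  have h3 : ‖R w‖ ^ 2 - ‖T h (R w)‖ ^ 2 = RCLike.re ⟪w, ∫ s in (0 : ℝ)..2 * h, T s w⟫ := by
    rw [← hT.negFracPow_half_sq_sub hω hb h2, inner_sub_right, map_sub,
      norm_sq_eq_re_inner (𝕜 := 𝕜) (R w), norm_sq_eq_re_inner (𝕜 := 𝕜) (T h (R w)),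
      hsymm hh, ← ContinuousLinearMap.comp_apply (T h), ← hT.map_add _ _ hh hh, ← two_mul,
      hRs, hRs]
    simp only [hR, hT.orbit_negFracPow_half_comm hω hb h2]
  have h4 : RCLike.re ⟪w, ∫ s in (0 : ℝ)..2 * h, T s w⟫ =
      ∫ s in (0 : ℝ)..2 * h, RCLike.re ⟪w, T s w⟫ :=
    ((RCLike.reCLM.comp ((innerSL 𝕜 w).restrictScalars ℝ)).intervalIntegral_comp_comm
      (hT.intervalIntegrable_orbit hω.le hb h2 w)).symm
  have h5 := intervalIntegral.smul_integral_comp_mul_left (a := 0) (b := h)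
    (fun s => RCLike.re ⟪w, T s w⟫) 2
  rw [h3, h4, ← mul_zero (2 : ℝ), ← h5, mul_zero, smul_eq_mul, mul_div_cancel_left₀ _ two_ne_zero]
  refine intervalIntegral.integral_congr fun s hs => ?_
  rw [uIcc_of_le hh] at hs
  rw [two_mul, hT.map_add s s hs.1 hs.1, ContinuousLinearMap.comp_apply, ← hsymm hs.1,
    norm_sq_eq_re_inner (𝕜 := 𝕜)]

end SelfAdjoint

/-! ### Duality for convolutions and the energy estimate. -/

section EnergyEstimate

variable {𝕜 X : Type*} [RCLike 𝕜] [NormedAddCommGroup X] [InnerProductSpace 𝕜 X]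
  {T : ℝ → X →L[𝕜] X} {M ω : ℝ} {A : X →ₗ.[𝕜] X} {g : ℝ → X} {h : ℝ}

local notation "⟪" x ", " y "⟫" => inner 𝕜 x y

theorem IsC0Semigroup.continuousOn_convolution {E : Type*} [NormedAddCommGroup E] [NormedSpace 𝕜 E]
    {T : ℝ → E →L[𝕜] E} {g : ℝ → E} (hT : IsC0Semigroup T) (hω : 0 ≤ ω)
    (hb : ∀ t : ℝ, 0 ≤ t → ‖T t‖ ≤ M * Real.exp (-ω * t)) (hg : ContinuousOn g (Icc 0 h)) :
    ContinuousOn (fun s => T (h - s) (g s)) (Icc 0 h) := by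
  have hM0 : 0 ≤ M := by simpa using (norm_nonneg _).trans (hb 0 le_rfl)
  have hM : ∀ t : ℝ, 0 ≤ t → ‖T t‖ ≤ M := fun t ht =>
    (hb t ht).trans (mul_le_of_le_one_right hM0 (Real.exp_le_one_iff.2 (by nlinarith)))
  intro s hs
  have h1 : Tendsto (fun r => T (h - r) (g s)) (𝓝[Icc 0 h] s) (𝓝 (T (h - s) (g s))) := by
    refine ((hT.continuousOn_orbit hω hb (g s)).comp (f := fun r => h - r) (by fun_prop)
      fun r hr => ?_) s hs
    exact sub_nonneg.2 hr.2
  have h2 : Tendsto (fun r => T (h - r) (g r - g s)) (𝓝[Icc 0 h] s) (𝓝 0) := by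
    have h3 : Tendsto (fun r => M * ‖g r - g s‖) (𝓝[Icc 0 h] s) (𝓝 0) := by
      simpa using (tendsto_iff_norm_sub_tendsto_zero.1 (hg s hs)).const_mul M
    refine squeeze_zero_norm' ?_ h3
    filter_upwards [self_mem_nhdsWithin] with r hr
    exact (T (h - r)).le_of_opNorm_le (hM _ (sub_nonneg.2 hr.2)) _
  have h4 := h2.add h1
  simpa [ContinuousWithinAt] using h4

/-- By density and continuity the test vector may be x itself, and half of ‖x‖² is absorbed. -/
theorem norm_sq_le_of_re_inner_le {Y : Type*} {R : Y → X} (hR : DenseRange R) {x : X} {K : ℝ}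
    (hK : ∀ w, RCLike.re ⟪x, R w⟫ ≤ K / 2 + ‖R w‖ ^ 2 / 2) : ‖x‖ ^ 2 ≤ K := by
  have h1 := hR.induction_on (p := fun y => RCLike.re ⟪x, y⟫ ≤ K / 2 + ‖y‖ ^ 2 / 2) x
    (isClosed_le (by fun_prop) (by fun_prop)) hK
  rw [← norm_sq_eq_re_inner] at h1
  linarith

variable [NormedSpace ℝ X] [CompleteSpace X]

theorem IsGenerator.denseRange_negFracPow_half (hA : IsGenerator T A) (hT : IsC0Semigroup T)
    (hω : 0 < ω) (hb : ∀ t : ℝ, 0 ≤ t → ‖T t‖ ≤ M * Real.exp (-ω * t))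
    (hself : IsSelfAdjoint A) : DenseRange (negFracPow T (1 / 2)) := by
  have h1 : (LinearMap.range (negFracPow T (1 / 2)).toLinearMap).topologicalClosure = ⊤ := by
    rw [Submodule.topologicalClosure_eq_top_iff,
      LinearMap.IsSymmetric.orthogonal_range (hA.inner_negFracPow_half hT hω hb hself)]
    exact LinearMap.ker_eq_bot.2 (hA.negFracPow_half_injective hT hω hb)
  exact Submodule.dense_iff_topologicalClosure_eq_top.2 h1

/-- Move T(h-s) onto w by symmetry, apply Young's inequality pointwise, and evaluate ∫‖T(s)w‖² by
the energy identity. -/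
theorem IsGenerator.norm_inner_convolution_le (hA : IsGenerator T A) (hT : IsC0Semigroup T)
    (hω : 0 < ω) (hb : ∀ t : ℝ, 0 ≤ t → ‖T t‖ ≤ M * Real.exp (-ω * t)) (hself : IsSelfAdjoint A)
    (hh : 0 ≤ h) (hg : ContinuousOn g (Icc 0 h)) (w : X) :
    ‖⟪w, ∫ s in (0 : ℝ)..h, T (h - s) (g s)⟫‖ ≤ (∫ s in (0 : ℝ)..h, ‖g s‖ ^ 2) / 2 +
      (‖negFracPow T (1 / 2) w‖ ^ 2 - ‖T h (negFracPow T (1 / 2) w)‖ ^ 2) / 4 := by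
  have hI : IntervalIntegrable (fun s => T (h - s) (g s)) volume 0 h :=
    ContinuousOn.intervalIntegrable (by
      rw [uIcc_of_le hh]; exact hT.continuousOn_convolution hω.le hb hg)
  have hI1 : IntervalIntegrable (fun s => ‖g s‖ ^ 2 / 2) volume 0 h :=
    ContinuousOn.intervalIntegrable (by rw [uIcc_of_le hh]; fun_prop)
  have hI2 : IntervalIntegrable (fun s => ‖T (h - s) w‖ ^ 2 / 2) volume 0 h :=
    ContinuousOn.intervalIntegrable (by
      rw [uIcc_of_le hh]
      exact ((hT.continuousOn_convolution hω.le hb (g := fun _ => w)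
        continuousOn_const).norm.pow 2).div_const 2)
  have h1 : ⟪w, ∫ s in (0 : ℝ)..h, T (h - s) (g s)⟫ = ∫ s in (0 : ℝ)..h, ⟪w, T (h - s) (g s)⟫ :=
    (((innerSL 𝕜 w).restrictScalars ℝ).intervalIntegral_comp_comm hI).symm
  have h2 : ∫ s in (0 : ℝ)..h, ‖T (h - s) w‖ ^ 2 = ∫ s in (0 : ℝ)..h, ‖T s w‖ ^ 2 := by
    simpa using intervalIntegral.integral_comp_sub_left (a := 0) (b := h) (fun s => ‖T s w‖ ^ 2) h
  have h3 : ‖∫ s in (0 : ℝ)..h, ⟪w, T (h - s) (g s)⟫‖ ≤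
      ∫ s in (0 : ℝ)..h, (‖g s‖ ^ 2 / 2 + ‖T (h - s) w‖ ^ 2 / 2) := by
    refine intervalIntegral.norm_integral_le_of_norm_le hh ?_ (hI1.add hI2)
    refine Eventually.of_forall fun s hs => ?_
    rw [← hA.inner_orbit hT hω hb hself (sub_nonneg.2 hs.2)]
    refine (norm_inner_le_norm _ _).trans ?_
    nlinarith [sq_nonneg (‖T (h - s) w‖ - ‖g s‖)]
  rw [h1]
  refine h3.trans_eq ?_
  rw [intervalIntegral.integral_add hI1 hI2, intervalIntegral.integral_div,
    intervalIntegral.integral_div, h2, hA.integral_norm_orbit_sq hT hω hb hself hh]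
  ring

/-- Convolutions with continuous functions take values in the range of `(-A)^{-1/2}`. -/
theorem IsGenerator.exists_negFracPow_half_eq_convolution (hA : IsGenerator T A)
    (hT : IsC0Semigroup T) (hω : 0 < ω) (hb : ∀ t : ℝ, 0 ≤ t → ‖T t‖ ≤ M * Real.exp (-ω * t))
    (hself : IsSelfAdjoint A) (hh : 0 ≤ h) (hg : ContinuousOn g (Icc 0 h)) :
    ∃ z, negFracPow T (1 / 2) z = ∫ s in (0 : ℝ)..h, T (h - s) (g s) := by
  have hle := hA.norm_inner_convolution_le hT hω hb hself hh hg
  set R := negFracPow T (1 / 2) with hR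
  set v := ∫ s in (0 : ℝ)..h, T (h - s) (g s)
  have hinj := hA.negFracPow_half_injective hT hω hb
  have hK0 : 0 ≤ ∫ s in (0 : ℝ)..h, ‖g s‖ ^ 2 :=
    intervalIntegral.integral_nonneg hh fun s _ => sq_nonneg _
  set K := ∫ s in (0 : ℝ)..h, ‖g s‖ ^ 2
  have hbound : ∀ w, ‖⟪v, w⟫‖ ≤ (K / 2 + 1 / 4) * ‖R w‖ := fun w => by
    rcases eq_or_ne w 0 with rfl | hw
    · simp
    have hRw : 0 < ‖R w‖ := norm_pos_iff.2 fun h0 => hw (hinj (by rw [h0, map_zero]))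
    -- Scaling to ‖Rw‖ = 1 turns the quadratic bound into a linear one with constant K/2 + 1/4.
    have h1 := hle (((‖R w‖⁻¹ : ℝ) : 𝕜) • w)
    rw [inner_smul_left, map_smul, norm_mul, norm_smul, RCLike.norm_conj, RCLike.norm_ofReal,
      abs_of_pos (inv_pos.2 hRw), inv_mul_cancel₀ hRw.ne', norm_inner_symm] at h1
    rw [← inv_mul_le_iff₀' hRw]
    nlinarith [sq_nonneg ‖T h (((‖R w‖⁻¹ : ℝ) : 𝕜) • R w)‖]
  let e := LinearEquiv.ofInjective R.toLinearMap hinj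
  have he : ∀ w, (e w : X) = R w := fun _ => rfl
  -- The functional Rw ↦ ⟪v, w⟫ is well defined by injectivity of R. The Riesz vector z of its
  -- extension satisfies ⟪z, Rw⟫ = ⟪v, w⟫, that is, Rz = v.
  let f : StrongDual 𝕜 (LinearMap.range R.toLinearMap) :=
    ((innerSL 𝕜 v).toLinearMap ∘ₗ e.symm.toLinearMap).mkContinuous (K / 2 + 1 / 4) fun y => by
      obtain ⟨w, rfl⟩ := e.surjective y
      simpa [he] using hbound w
  obtain ⟨F, hF, -⟩ := exists_extension_norm_eq _ f
  refine ⟨(InnerProductSpace.toDual 𝕜 X).symm F, ext_inner_right 𝕜 fun w => ?_⟩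
  rw [hA.inner_negFracPow_half hT hω hb hself, InnerProductSpace.toDual_symm_apply]
  have h2 := hF (e w)
  rw [he] at h2
  rw [h2]
  simp [f]

/-- The energy estimate for the mild solution, expressed after applying `(-A)^{-1/2}`. -/
theorem IsGenerator.norm_sq_le (hA : IsGenerator T A)
    (hT : IsC0Semigroup T) (hω : 0 < ω) (hb : ∀ t : ℝ, 0 ≤ t → ‖T t‖ ≤ M * Real.exp (-ω * t))
    (hself : IsSelfAdjoint A) (hh : 0 ≤ h) (hg : ContinuousOn g (Icc 0 h)) {x x₀ : X}
    (hx : negFracPow T (1 / 2) x =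
      negFracPow T (1 / 2) (T h x₀) + ∫ s in (0 : ℝ)..h, T (h - s) (g s)) :
    ‖x‖ ^ 2 ≤ Real.exp (-ω * h) * ‖x₀‖ ^ 2 + ∫ s in (0 : ℝ)..h, ‖g s‖ ^ 2 := by
  refine norm_sq_le_of_re_inner_le (𝕜 := 𝕜)
    (hA.denseRange_negFracPow_half hT hω hb hself) fun w => ?_
  have hRs := hA.inner_negFracPow_half hT hω hb hself
  have h1 := hA.norm_inner_convolution_le hT hω hb hself hh hg w
  set R := negFracPow T (1 / 2) with hR
  set K := ∫ s in (0 : ℝ)..h, ‖g s‖ ^ 2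
  have hp := Real.exp_pos (-ω * h)
  have hp1 : Real.exp (-ω * h) ≤ 1 := Real.exp_le_one_iff.2 (by nlinarith)
  have h2 : ‖T h (R w)‖ ≤ Real.exp (-ω * h) * ‖R w‖ :=
    (T h).le_of_opNorm_le (hA.norm_orbit_le_exp hT hω hb hself hh) _
  have h3 : RCLike.re ⟪T h x₀, R w⟫ ≤ ‖x₀‖ * ‖T h (R w)‖ := by
    rw [hA.inner_orbit hT hω hb hself hh]
    exact re_inner_le_norm _ _
  have h4 : RCLike.re ⟪x, R w⟫ ≤ ‖x₀‖ * ‖T h (R w)‖ +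
      (K / 2 + (‖R w‖ ^ 2 - ‖T h (R w)‖ ^ 2) / 4) := by
    rw [← hRs, hx, inner_add_left, map_add, hRs]
    refine add_le_add h3 ((RCLike.re_le_norm _).trans ?_)
    rwa [norm_inner_symm]
  refine h4.trans ?_
  have hb0 := norm_nonneg (T h (R w))
  set p := Real.exp (-ω * h)
  set b := ‖T h (R w)‖
  -- Young's inequality with weight p = e^{-ωh} puts the decay factor on ‖x₀‖². The remaining b²
  -- terms are controlled by b ≤ p‖Rw‖ and p/2 - p²/4 ≤ 1/4.
  have h5 : ‖x₀‖ * b ≤ p * ‖x₀‖ ^ 2 / 2 + b ^ 2 / (2 * p) := by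
    have h6 : p * ‖x₀‖ ^ 2 / 2 + b ^ 2 / (2 * p) - ‖x₀‖ * b = (p * ‖x₀‖ - b) ^ 2 / (2 * p) := by
      field_simp; ring
    have h7 : 0 ≤ (p * ‖x₀‖ - b) ^ 2 / (2 * p) := by positivity
    linarith
  have h8 : b ^ 2 * (1 / (2 * p) - 1 / 4) ≤ ‖R w‖ ^ 2 / 4 := by
    have h9 : 0 ≤ 1 / (2 * p) - 1 / 4 := by
      have : 1 / 2 ≤ 1 / (2 * p) := one_div_le_one_div_of_le (by positivity) (by linarith)
      linarith
    calc b ^ 2 * (1 / (2 * p) - 1 / 4) ≤ (p * ‖R w‖) ^ 2 * (1 / (2 * p) - 1 / 4) := by gcongr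
      _ = ‖R w‖ ^ 2 * (p / 2 - p ^ 2 / 4) := by field_simp
      _ ≤ ‖R w‖ ^ 2 * (1 / 4) :=
        mul_le_mul_of_nonneg_left (by nlinarith [sq_nonneg (p - 1)]) (sq_nonneg _)
      _ = ‖R w‖ ^ 2 / 4 := by ring
  have h10 : b ^ 2 * (1 / (2 * p) - 1 / 4) = b ^ 2 / (2 * p) - b ^ 2 / 4 := by ring
  linarith

end EnergyEstimate

/-! ### Realising the completions inside X. -/

section Extrapolation

variable {𝕜 X : Type*} [RCLike 𝕜] [NormedAddCommGroup X] [NormedSpace 𝕜 X] [CompleteSpace X]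

/-- The isometric extension of `R` to the completion of `X` with respect to `x ↦ ‖R x‖`. -/
noncomputable def fromExtrap (R : X →L[𝕜] X) : Extrap R →L[𝕜] X :=
  ContinuousLinearMap.fromCompletion
    ((NormVia.toX R).mkContinuous 1 fun x => by rw [one_mul]; exact le_rfl)

theorem fromExtrap_coe (R : X →L[𝕜] X) (x : NormVia R) :
    fromExtrap R (x : Extrap R) = NormVia.toX R x :=
  ContinuousLinearMap.fromCompletion_apply_coe _ _

theorem fromExtrap_toExtrap (R : X →L[𝕜] X) (x : X) : fromExtrap R (toExtrap R x) = R x :=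
  fromExtrap_coe R x

theorem norm_fromExtrap (R : X →L[𝕜] X) (ξ : Extrap R) : ‖fromExtrap R ξ‖ = ‖ξ‖ := by
  induction ξ using UniformSpace.Completion.induction_on with
  | hp => exact isClosed_eq (by fun_prop) (by fun_prop)
  | ih x => rw [fromExtrap_coe, UniformSpace.Completion.norm_coe]; rfl

theorem isometry_fromExtrap (R : X →L[𝕜] X) : Isometry (fromExtrap R) :=
  AddMonoidHomClass.isometry_of_norm _ (norm_fromExtrap R)

theorem fromExtrap_incl (A : X →ₗ.[𝕜] X) (a : 𝕜) (x : X) :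
    fromExtrap (resolventOp A a) (incl A a x) = resolventOp A a x :=
  fromExtrap_toExtrap _ x

/-- If `R' S = L R`, then the extension of `S` between the completions is intertwined with `L`. -/
theorem fromExtrap_extendMap {R R' S L : X →L[𝕜] X} (h : ∀ x, R' (S x) = L (R x)) (ξ : Extrap R) :
    fromExtrap R' (extendMap R R' S ξ) = L (fromExtrap R ξ) := by
  let f : NormVia R →ₗ[𝕜] NormVia R' := S.toLinearMap
  have hf : UniformContinuous f := by
    refine (f.mkContinuous ‖L‖ fun x => ?_).uniformContinuous
    exact (congrArg norm (h x)).trans_le (L.le_opNorm (R x))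
  have hm : extendMap R R' S = UniformSpace.Completion.map f := rfl
  rw [hm]
  induction ξ using UniformSpace.Completion.induction_on with
  | hp =>
    exact isClosed_eq ((fromExtrap R').continuous.comp UniformSpace.Completion.continuous_map)
      (L.continuous.comp (fromExtrap R).continuous)
  | ih x =>
    rw [UniformSpace.Completion.map_coe hf, fromExtrap_coe, fromExtrap_coe]
    exact h x

end Extrapolation

/-! ### Transfer of the mild solution identity to X. -/

section MildSolutions

variable {𝕜 X U : Type*} [RCLike 𝕜] [NormedAddCommGroup X] [NormedSpace 𝕜 X]
  [NormedSpace ℝ X] [CompleteSpace X] [NormedAddCommGroup U] [NormedSpace 𝕜 U]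
  {T : ℝ → X →L[𝕜] X} {A : X →ₗ.[𝕜] X} {a : 𝕜} {M ω : ℝ} {B : U →L[𝕜] XMinusOne A a}
  {B' : U →L[𝕜] XMinus T (1 / 2)} {u : ℝ → U} {t : ℝ}

/-- Since Q = PR², the extended Q acts on the image of X_{-1/2} as PR after the extended R; T(t-s)
commutes with Q and R. -/
theorem fromExtrap_inputIntegrand (hT : IsC0Semigroup T) (hA : IsGenerator T A) (hω : 0 < ω)
    (hb : ∀ t : ℝ, 0 ≤ t → ‖T t‖ ≤ M * Real.exp (-ω * t)) (ha : a ∈ resolventSet A)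
    (hB : ∀ v : U, inclMinus A a T (1 / 2) (B' v) = B v) {s : ℝ} (hs : s ≤ t) :
    fromExtrap (resolventOp A a) (inputIntegrand A a T B u t s) =
      (ContinuousLinearMap.id 𝕜 X - a • resolventOp A a)
        (negFracPow T (1 / 2) (T (t - s) (fromExtrap (negFracPow T (1 / 2)) (B' (u s))))) := by
  have hQ := resolventOp_spec A ha
  have hts := sub_nonneg.2 hs
  set P := ContinuousLinearMap.id 𝕜 X - a • resolventOp A a
  have h1 : ∀ ξ, fromExtrap (resolventOp A a) (inclMinus A a T (1 / 2) ξ) =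
      P (negFracPow T (1 / 2) (fromExtrap (negFracPow T (1 / 2)) ξ)) := fun ξ =>
    fromExtrap_extendMap (L := P.comp (negFracPow T (1 / 2)))
      (fun x => hQ.eq_negFracPow hA hT hω hb x) ξ
  rw [inputIntegrand, extSemigroup, fromExtrap_extendMap (L := T (t - s))
    (fun x => hQ.orbit_comm hA hT hts x), ← hB, h1, ← hT.orbit_negFracPow_half_comm hω hb hts]
  simp [P, hQ.orbit_comm hA hT hts]

theorem continuousOn_inputIntegrand (hT : IsC0Semigroup T) (hA : IsGenerator T A) (hω : 0 < ω)
    (hb : ∀ t : ℝ, 0 ≤ t → ‖T t‖ ≤ M * Real.exp (-ω * t)) (ha : a ∈ resolventSet A)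
    (hB : ∀ v : U, inclMinus A a T (1 / 2) (B' v) = B v) (hu : ContinuousOn u (Icc 0 t)) :
    ContinuousOn (inputIntegrand A a T B u t) (Icc 0 t) := by
  rw [← (isometry_fromExtrap (resolventOp A a)).comp_continuousOn_iff]
  refine ContinuousOn.congr ?_ fun s hs => fromExtrap_inputIntegrand hT hA hω hb ha hB hs.2
  refine (ContinuousLinearMap.continuous _).comp_continuousOn
    ((ContinuousLinearMap.continuous _).comp_continuousOn ?_)
  exact hT.continuousOn_convolution hω.le hb
    (((fromExtrap _).continuous.comp B'.continuous).comp_continuousOn hu)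

theorem fromExtrap_integral_inputIntegrand (hT : IsC0Semigroup T) (hA : IsGenerator T A)
    (hω : 0 < ω) (hb : ∀ t : ℝ, 0 ≤ t → ‖T t‖ ≤ M * Real.exp (-ω * t)) (ha : a ∈ resolventSet A)
    (hB : ∀ v : U, inclMinus A a T (1 / 2) (B' v) = B v) (ht : 0 ≤ t)
    (hu : ContinuousOn u (Icc 0 t)) :
    fromExtrap (resolventOp A a) (∫ s in (0 : ℝ)..t, inputIntegrand A a T B u t s) =
      (ContinuousLinearMap.id 𝕜 X - a • resolventOp A a) (negFracPow T (1 / 2)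
        (∫ s in (0 : ℝ)..t, T (t - s) (fromExtrap (negFracPow T (1 / 2)) (B' (u s))))) := by
  have hI := (continuousOn_inputIntegrand hT hA hω hb ha hB hu)
  have hJ : ContinuousOn (fun s => T (t - s) (fromExtrap (negFracPow T (1 / 2)) (B' (u s))))
      (Icc 0 t) := hT.continuousOn_convolution hω.le hb
    (((fromExtrap _).continuous.comp B'.continuous).comp_continuousOn hu)
  rw [← uIcc_of_le ht] at hI hJ
  set P := ContinuousLinearMap.id 𝕜 X - a • resolventOp A a
  rw [← ContinuousLinearMap.intervalIntegral_comp_comm _ hI.intervalIntegrable,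
    ← ContinuousLinearMap.comp_apply,
    ← ContinuousLinearMap.intervalIntegral_comp_comm _ hJ.intervalIntegrable]
  refine intervalIntegral.integral_congr fun s hs => ?_
  rw [uIcc_of_le ht] at hs
  exact fromExtrap_inputIntegrand hT hA hω hb ha hB hs.2

/-- After applying `(-A)^{-1/2}` the identity defining mild solutions becomes an identity in `X`. -/
theorem incl_eq_iff (hT : IsC0Semigroup T) (hA : IsGenerator T A)
    (hω : 0 < ω) (hb : ∀ t : ℝ, 0 ≤ t → ‖T t‖ ≤ M * Real.exp (-ω * t)) (ha : a ∈ resolventSet A)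
    (hB : ∀ v : U, inclMinus A a T (1 / 2) (B' v) = B v) (ht : 0 ≤ t)
    (hu : ContinuousOn u (Icc 0 t)) (z y : X) :
    incl A a z = incl A a y + ∫ s in (0 : ℝ)..t, inputIntegrand A a T B u t s ↔
      negFracPow T (1 / 2) z = negFracPow T (1 / 2) y +
        ∫ s in (0 : ℝ)..t, T (t - s) (fromExtrap (negFracPow T (1 / 2)) (B' (u s))) := by
  have hQ := resolventOp_spec A ha
  -- Under the extended Q every term takes the form PR(·), and both P and R are injective.
  rw [← (isometry_fromExtrap (resolventOp A a)).injective.eq_iff, map_add,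
    fromExtrap_incl, fromExtrap_incl,
    fromExtrap_integral_inputIntegrand hT hA hω hb ha hB ht hu,
    hQ.eq_negFracPow hA hT hω hb z, hQ.eq_negFracPow hA hT hω hb y, ← map_add, ← map_add,
    (hQ.id_sub_smul_injective hA hT hω hb).eq_iff,
    (hA.negFracPow_half_injective hT hω hb).eq_iff]

end MildSolutions

/-- The majorant touches f at 0, so its difference quotients dominate those of f, which need not
converge. -/
theorem diniAtZero_le {f k : ℝ → ℝ} {k' : ℝ} (hk : HasDerivWithinAt k k' (Ici 0) 0)
    (h0 : k 0 = f 0) (hle : ∀ h, 0 < h → f h ≤ k h) : diniAtZero f ≤ (k' : EReal) := by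
  rw [hasDerivWithinAt_iff_tendsto_slope, Ici_sdiff_left] at hk
  have hlim : Tendsto (fun h => ((slope k 0 h : ℝ) : EReal)) (𝓝[>] 0) (𝓝 (k' : EReal)) :=
    (continuous_coe_real_ereal.tendsto k').comp hk
  rw [← hlim.limsup_eq]
  refine limsup_le_limsup ?_
  filter_upwards [self_mem_nhdsWithin] with h (hh : 0 < h)
  rw [EReal.coe_le_coe_iff, slope_def_field, sub_zero, h0]
  gcongr
  exact hle h hh

end LinSys

theorem mainTheorem5 {𝕜 X U : Type*} [RCLike 𝕜]
    [NormedAddCommGroup X] [InnerProductSpace 𝕜 X] [NormedSpace ℝ X] [CompleteSpace X]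
    [NormedAddCommGroup U] [NormedSpace 𝕜 U] [CompleteSpace U]
    (T : ℝ → X →L[𝕜] X) (A : X →ₗ.[𝕜] X)
    (hT : LinSys.IsC0Semigroup T) (hA : LinSys.IsGenerator T A)
    (hstable : LinSys.IsExpStable T) (hself : IsSelfAdjoint A)
    (a : 𝕜) (ha : a ∈ LinSys.resolventSet A)
    (B : U →L[𝕜] LinSys.XMinusOne A a) (hB : LinSys.MemLXMinus A a T (1 / 2) B) :
    LinSys.IsCoerciveQuadraticLpISSLyapunov A a T B 2 (fun x : X => (1 / 2 : ℝ) * ‖x‖ ^ 2) := by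
  obtain ⟨M, ω, hω, hb⟩ := hstable
  obtain ⟨B', hB⟩ := hB
  set G : U →L[𝕜] X := (LinSys.fromExtrap (LinSys.negFracPow T (1 / 2))).comp B' with hG
  refine { admissible := ?_, continuous := by fun_prop, nonneg := fun x => by positivity,
           sandwich := ?_, decay := ?_, quadratic := ?_, coercive := ?_ }
  · intro t ht u hu
    refine ⟨ContinuousOn.intervalIntegrable (by
      rw [uIcc_of_le ht]
      exact LinSys.continuousOn_inputIntegrand hT hA hω hb ha hB hu), ?_⟩
    obtain ⟨z, hz⟩ := hA.exists_negFracPow_half_eq_convolution hT hω hb hself ht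
      (G.continuous.comp_continuousOn hu)
    refine ⟨z, ?_⟩
    have h := (LinSys.incl_eq_iff hT hA hω hb ha hB ht hu z 0).2 (by
      rw [hz, map_zero, zero_add]; rfl)
    rw [h, add_eq_right]
    apply (LinSys.isometry_fromExtrap (LinSys.resolventOp A a)).injective
    rw [LinSys.fromExtrap_incl, map_zero, map_zero]
  · refine ⟨fun r => 1 / 2 * r ^ 2, ⟨by fun_prop, fun r hr s hs hrs => ?_, by simp,
      (tendsto_pow_atTop two_ne_zero).const_mul_atTop (by norm_num)⟩, fun x hx => ⟨?_, le_rfl⟩⟩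
    · have : 0 ≤ r := hr
      gcongr
    · have := norm_pos_iff.2 hx
      positivity
  -- Both constants come from half the derivative of the majorant at 0; the added 1 keeps the second
  -- positive when G = 0.
  · refine ⟨ω / 2, ‖G‖ ^ 2 / 2 + 1, by positivity, by positivity, fun x₀ u hu x hx => ?_⟩
    have hx' : ∀ t, 0 ≤ t → ‖x t‖ ^ 2 ≤
        Real.exp (-ω * t) * ‖x₀‖ ^ 2 + ∫ s in (0 : ℝ)..t, ‖G (u s)‖ ^ 2 := fun t ht => by
      have hut : ContinuousOn u (Icc 0 t) := hu.mono Icc_subset_Ici_self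
      exact hA.norm_sq_le hT hω hb hself ht (G.continuous.comp_continuousOn hut)
        ((LinSys.incl_eq_iff hT hA hω hb ha hB ht hut _ _).1 (hx t ht))
    -- The identity at t = 0 and injectivity of R force the initial value.
    have hx0 : x 0 = x₀ := by
      have h := (LinSys.incl_eq_iff hT hA hω hb ha hB le_rfl
        (hu.mono (Icc_subset_Ici_self (a := 0) (b := 0))) _ _).1 (hx 0 le_rfl)
      rw [intervalIntegral.integral_same, add_zero, hT.map_zero] at h
      exact hA.negFracPow_half_injective hT hω hb h
    have hgc : ContinuousOn (fun s => ‖G (u s)‖ ^ 2) (Ici 0) :=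
      (G.continuous.comp_continuousOn hu).norm.pow 2
    have hd1 : HasDerivWithinAt (fun t => ∫ s in (0 : ℝ)..t, ‖G (u s)‖ ^ 2) (‖G (u 0)‖ ^ 2)
        (Ici 0) 0 :=
      intervalIntegral.integral_hasDerivWithinAt_right (s := Ici 0) (t := Ioi 0) (by simp)
        ((hgc.mono Ioi_subset_Ici_self).stronglyMeasurableAtFilter_nhdsWithin measurableSet_Ioi 0)
        ((hgc 0 self_mem_Ici).mono Ioi_subset_Ici_self)
    have hd2 : HasDerivAt (fun t : ℝ => Real.exp (-ω * t) * ‖x₀‖ ^ 2) (-ω * ‖x₀‖ ^ 2) 0 := by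
      simpa using (((hasDerivAt_id (0 : ℝ)).const_mul (-ω)).exp).mul_const (‖x₀‖ ^ 2)
    refine (LinSys.diniAtZero_le ((hd2.hasDerivWithinAt.add hd1).const_mul (1 / 2)) (by simp [hx0])
      fun h hh => mul_le_mul_of_nonneg_left (hx' h hh.le) (by norm_num)).trans ?_
    rw [EReal.coe_le_coe_iff, Real.rpow_two]
    have hGu : ‖G (u 0)‖ ^ 2 ≤ ‖G‖ ^ 2 * ‖u 0‖ ^ 2 := by
      rw [← mul_pow]
      gcongr
      exact G.le_opNorm _
    nlinarith [sq_nonneg ‖u 0‖]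
  · refine ⟨((√(1 / 2) : ℝ) : 𝕜) • ContinuousLinearMap.id 𝕜 X, ?_, fun x => ?_⟩
    · have h : ((√(1 / 2) : ℝ) : 𝕜) ≠ 0 := by
        rw [RCLike.ofReal_ne_zero]; positivity
      exact smul_right_injective X h
    · have h : ‖((√(1 / 2) : ℝ) : 𝕜)‖ ^ 2 = 1 / 2 := by
        rw [RCLike.norm_ofReal, sq_abs, Real.sq_sqrt (by norm_num)]
      rw [smul_apply, norm_smul, mul_pow, h]
      rfl
  · exact ⟨1 / 2, 1 / 2, by norm_num, by norm_num, fun x => ⟨le_rfl, le_rfl⟩⟩
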